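/- Let $k\ge 1$ and let $\alpha_p,\beta_p,\eta_p\in\mathbb{C}$, $1\le p\le k$, satisfy $\prod_{p=1}^k\eta_p\ne 0$ and $\prod_{p=1}^k\beta_p\neq 0$; extend them $k$-periodically to all indices $p\ge 1$. For $a\in\mathbb{C}$ let $T^a(f)$ be the perturbed tridiagonal $k$-Toeplitz operator, i.e. the bounded operator on $\ell^2(\mathbb{N},\mathbb{C})$ given by the tridiagonal matrix with entries $$T^a(f)_{1,1}=\alpha_1+a,\qquad T^a(f)_{j,j}=\alpha_j\ (j\ge 2),\qquad T^a(f)_{j,j+1}=\beta_j,\qquad T^a(f)_{j+1,j}=\eta_j\quad (j\ge 1).$$ Its symbol is $f(z)=A_{-1}z^{-1}+A_0+A_1z\in\mathbb{C}^{k\times k}$, $|z|=1$, where $A_0$ is the tridiagonal matrix with diagonal $(\alpha_1,\dots,\alpha_k)$, superdiagonal $(\beta_1,\dots,\beta_{k-1})$ and subdiagonal $(\eta_1,\dots,\eta_{k-1})$, the only nonzero entry of $A_{-1}$ is $\beta_k$ in position $(k,1)$, and the only nonzero entry of $A_1$ is $\eta_k$ in position $(1,k)$. Let $\lambda\in\mathbb{C}\setminus\sigma_{\mathrm{ess}}(T^a(f))$,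 i.e. $T^a(f)-\lambda$ is a Fredholm operator. Let $\lambda_1,\dots,\lambda_k:[0,2\pi]\to\mathbb{C}$ be continuous functions such that, for every $t$, $\lambda_1(t),\dots,\lambda_k(t)$ are the eigenvalues of $f(e^{it})$ listed with algebraic multiplicity. Let $\operatorname{wind}(\lambda_j,\lambda)$ be the total increment over $[0,2\pi]$ of a continuous argument of $\lambda_j(t)-\lambda$, divided by $2\pi$. (Concatenating the curves whose endpoints match yields closed loops, and $\sum_{j=1}^k\operatorname{wind}(\lambda_j,\lambda)\in\mathbb{Z}$ is the sum of the winding numbers of these loops about $\lambda$.) There is a constant $C_1>0$ that depends only on $\lambda$ and $\alpha_p,\beta_p,\eta_p$, $1\le p\le k$ (in particular not on $a$), such that the following holds. 1. If $\sum_{j=1}^k\operatorname{wind}(\lambda_j,\lambda)<0$, then there exist an eigenvector $x\in\ell^2(\mathbb{N},\mathbb{C})$ of $T^a(f)$ associated to $\lambda$ and some $\rho\in(0,1)$ such that $$\frac{|x_j|}{\max_i|x_i|}\le C_1\lceil j/k\rceil\,\rho^{\lceil j/k\rceil-1},\qquad j\ge 1.$$ 2. If $\sum_{j=1}^k\operatorname{wind}(\lambda_j,\lambda)>0$,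 then there exist a left eigenvector $x\in\ell^2(\mathbb{N},\mathbb{C})$ of $T^a(f)$ associated to $\lambda$ (that is, $x\neq 0$ and $x^{\top}T^a(f)=\lambda x^{\top}$) and some $\rho\in(0,1)$ for which the same bound holds. -/

import Mathlib

open Complex Polynomial

noncomputable section

namespace KToeplitz

/-- The Hilbert space of square-summable sequences. The entry with mathematical index `j ≥ 1`
of a sequence `x` is `x (j - 1)`, i.e. positions are counted from `0`. -/
abbrev EllTwo : Type := lp (fun _ : ℕ => ℂ) 2

variable {k : ℕ}

/-- The `k`-periodic extension `n ↦ c (n mod k)` of a finite list of coefficients. -/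
def periodic [NeZero k] (c : Fin k → ℂ) (n : ℕ) : ℂ := c (Fin.ofNat k n)

/-- Action on sequences of the semi-infinite tridiagonal matrix with `k`-periodic diagonal `α`,
superdiagonal `β` and subdiagonal `η`, in which `a` is added to the upper left diagonal entry. -/
def perturbedAction [NeZero k] (α β η : Fin k → ℂ) (a : ℂ) (x : ℕ → ℂ) : ℕ → ℂ
  | 0 => (periodic α 0 + a) * x 0 + periodic β 0 * x 1
  | n + 1 => periodic η n * x n + periodic α (n + 1) * x (n + 1) + periodic β (n + 1) * x (n + 2)

theorem memlp_iff (x : ℕ → ℂ) :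
    Memℓp (E := fun _ : ℕ => ℂ) x 2 ↔ Summable fun n => ‖x n‖ ^ 2 := by
  rw [memℓp_gen_iff (by norm_num)]
  simp

theorem memlp_shift {x : ℕ → ℂ} (hx : Memℓp (E := fun _ : ℕ => ℂ) x 2) :
    Memℓp (E := fun _ : ℕ => ℂ) (fun n => x (n + 1)) 2 := by
  rw [memlp_iff] at hx ⊢
  exact (summable_nat_add_iff 1).2 hx

theorem memlp_of_shift {x : ℕ → ℂ} (hx : Memℓp (E := fun _ : ℕ => ℂ) (fun n => x (n + 1)) 2) :
    Memℓp (E := fun _ : ℕ => ℂ) x 2 := by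
  rw [memlp_iff] at hx ⊢
  exact (summable_nat_add_iff 1).1 hx

theorem memlp_periodic_mul [NeZero k] (c : Fin k → ℂ) (s : ℕ) {x : ℕ → ℂ}
    (hx : Memℓp (E := fun _ : ℕ => ℂ) x 2) :
    Memℓp (E := fun _ : ℕ => ℂ) (fun n => periodic c (n + s) * x n) 2 := by
  rw [memlp_iff] at hx ⊢
  refine Summable.of_nonneg_of_le (fun _ => by positivity) (fun n => ?_)
    (hx.mul_left ((∑ i, ‖c i‖) ^ 2))
  rw [norm_mul, mul_pow]
  gcongr
  exact Finset.single_le_sum (f := fun i => ‖c i‖) (fun i _ => norm_nonneg _) (Finset.mem_univ _)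

theorem memlp_perturbedAction [NeZero k] (α β η : Fin k → ℂ) (a : ℂ) (x : EllTwo) :
    Memℓp (E := fun _ : ℕ => ℂ) (perturbedAction α β η a x) 2 := by
  apply memlp_of_shift
  have hx : Memℓp (E := fun _ : ℕ => ℂ) (x : ℕ → ℂ) 2 := lp.memℓp x
  have h1 := memlp_shift hx
  have h2 := ((memlp_periodic_mul η 0 hx).add (memlp_periodic_mul α 1 h1)).add
    (memlp_periodic_mul β 1 (memlp_shift h1))
  refine (congrArg (fun y : ℕ → ℂ => Memℓp (E := fun _ : ℕ => ℂ) y 2) ?_).mp h2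
  funext n
  simp [perturbedAction]

/-- The perturbed tridiagonal `k`-Toeplitz operator `T^a(f)` as a linear map of `ℓ²`. -/
def perturbedLinear [NeZero k] (α β η : Fin k → ℂ) (a : ℂ) : EllTwo →ₗ[ℂ] EllTwo where
  toFun x := ⟨perturbedAction α β η a x, memlp_perturbedAction α β η a x⟩
  map_add' x y := by
    ext n
    change perturbedAction α β η a ((x : ℕ → ℂ) + (y : ℕ → ℂ)) n =
      perturbedAction α β η a x n + perturbedAction α β η a y n
    cases n <;> simp only [Pi.add_apply, perturbedAction] <;> ring
  map_smul' r x := by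
    ext n
    change perturbedAction α β η a (r • (x : ℕ → ℂ)) n = r * perturbedAction α β η a x n
    cases n <;> simp only [Pi.smul_apply, perturbedAction, smul_eq_mul] <;> ring

theorem perturbedLinear_graph_closed [NeZero k] (α β η : Fin k → ℂ) (a : ℂ) :
    IsClosed ((perturbedLinear α β η a).graph : Set (EllTwo × EllTwo)) := by
  have hc : ∀ n : ℕ, Continuous fun x : EllTwo => x n := fun n =>
    (continuous_apply n).comp (lp.uniformContinuous_coe (p := 2)).continuous
  have : ((perturbedLinear α β η a).graph : Set (EllTwo × EllTwo)) =
      ⋂ n : ℕ, {p | p.2 n = perturbedAction α β η a p.1 n} := by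
    ext p
    simp only [SetLike.mem_coe, LinearMap.mem_graph_iff, Set.mem_iInter, Set.mem_ofPred_eq]
    constructor
    · intro h n
      rw [h]
      rfl
    · intro h
      ext n
      exact h n
  rw [this]
  refine isClosed_iInter fun n => isClosed_eq ((hc n).comp continuous_snd) ?_
  have h1 : ∀ m : ℕ, Continuous fun p : EllTwo × EllTwo => p.1 m :=
    fun m => (hc m).comp continuous_fst
  cases n with
  | zero => exact (continuous_const.mul (h1 0)).add (continuous_const.mul (h1 1))
  | succ n =>
    exact ((continuous_const.mul (h1 n)).add (continuous_const.mul (h1 (n + 1)))).add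
      (continuous_const.mul (h1 (n + 2)))

/-- The perturbed tridiagonal `k`-Toeplitz operator `T^a(f)` as a bounded operator on `ℓ²`. -/
def perturbedToeplitz [NeZero k] (α β η : Fin k → ℂ) (a : ℂ) : EllTwo →L[ℂ] EllTwo :=
  ContinuousLinearMap.ofIsClosedGraph (perturbedLinear_graph_closed α β η a)

theorem perturbedToeplitz_apply [NeZero k] (α β η : Fin k → ℂ) (a : ℂ) (x : EllTwo) (n : ℕ) :
    perturbedToeplitz α β η a x n = perturbedAction α β η a x n := rfl

/-- The diagonal block `A₀` of the block form of the operator. -/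
def blockZero (α β η : Fin k → ℂ) : Matrix (Fin k) (Fin k) ℂ := Matrix.of fun i j =>
  if i = j then α i
  else if (j : ℕ) = i + 1 then β i
  else if (i : ℕ) = j + 1 then η j
  else 0

/-- The block `A₋₁`: its only nonzero entry is the last `β`, in the lower left corner. -/
def blockNegOne (β : Fin k → ℂ) : Matrix (Fin k) (Fin k) ℂ := Matrix.of fun i j =>
  if (i : ℕ) + 1 = k ∧ (j : ℕ) = 0 then β i else 0

/-- The block `A₁`: its only nonzero entry is the last `η`, in the upper right corner. -/
def blockOne (η : Fin k → ℂ) : Matrix (Fin k) (Fin k) ℂ := Matrix.of fun i j =>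
  if (i : ℕ) = 0 ∧ (j : ℕ) + 1 = k then η j else 0

/-- The symbol `f(z) = A₋₁ z⁻¹ + A₀ + A₁ z` (used for `|z| = 1`). -/
def symbol (α β η : Fin k → ℂ) (z : ℂ) : Matrix (Fin k) (Fin k) ℂ :=
  z⁻¹ • blockNegOne β + blockZero α β η + z • blockOne η

/-- The essential spectrum of a bounded operator: all `z` for which `T - z` is not Fredholm. -/
def essentialSpectrum (T : EllTwo →L[ℂ] EllTwo) : Set ℂ :=
  {z | ¬ (T - z • ContinuousLinearMap.id ℂ EllTwo).IsFredholm}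

/-- `μ` is a family of eigenvalue curves of the matrix function `f` along the unit circle: the
`μ j` are continuous on `[0, 2π]`, and `μ 0 t, …, μ (k-1) t` are the eigenvalues of `f (exp (i t))`,
listed with algebraic multiplicity. -/
def IsEigenvalueCurves (f : ℂ → Matrix (Fin k) (Fin k) ℂ) (μ : Fin k → ℝ → ℂ) : Prop :=
  (∀ j, ContinuousOn (μ j) (Set.Icc 0 (2 * Real.pi))) ∧
  ∀ t ∈ Set.Icc (0 : ℝ) (2 * Real.pi),
    (f (exp (t * I))).charpoly = ∏ j, (X - C (μ j t))

/-- `g` is a continuous logarithm of `γ - z` along `[0, 2π]`. -/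
def IsLogLift (γ : ℝ → ℂ) (z : ℂ) (g : ℝ → ℂ) : Prop :=
  ContinuousOn g (Set.Icc 0 (2 * Real.pi)) ∧
  ∀ t ∈ Set.Icc (0 : ℝ) (2 * Real.pi), γ t - z = exp (g t)

open Classical in
/-- The winding number about `z` of the path `γ : [0, 2π] → ℂ ∖ {z}`: the total increment of a
continuous argument of `γ - z`, divided by `2π`. It does not depend on the chosen logarithm.
It is an integer if `γ` is closed; if closed loops are obtained by concatenating several paths
whose endpoints match, then the winding numbers of the loops are the sums of those of the paths.
(If `γ` meets `z` the winding number is undefined and the value `0` is not meaningful.) -/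
def wind (γ : ℝ → ℂ) (z : ℂ) : ℝ :=
  if h : ∃ g, IsLogLift γ z g then
    ((h.choose (2 * Real.pi)).im - (h.choose 0).im) / (2 * Real.pi)
  else 0

/-- `x` is a left eigenvector of `T` for the eigenvalue `z`: `x ≠ 0` and `xᵀ T = z xᵀ`, tested
on all of `ℓ²`. -/
def IsLeftEigenvector (T : EllTwo →L[ℂ] EllTwo) (z : ℂ) (x : EllTwo) : Prop :=
  x ≠ 0 ∧ ∀ y : EllTwo, ∑' i, x i * T y i = z * ∑' i, x i * y i

/-- The bound `|x_j| / max_i |x_i| ≤ C ⌈j/k⌉ ρ^(⌈j/k⌉ - 1)` for all `j ≥ 1`, where `x_j` is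
`x (j - 1)`. -/
def HasBlockDecay (k : ℕ) (C ρ : ℝ) (x : EllTwo) : Prop :=
  ∀ j : ℕ, 1 ≤ j →
    ‖x (j - 1)‖ / (⨆ i, ‖x i‖) ≤
      C * (⌈(j : ℝ) / k⌉₊ : ℝ) * ρ ^ (⌈(j : ℝ) / k⌉₊ - 1)

end KToeplitz

end

/-! All rows of `T^a x = lam x` except the first form a second order recurrence with periodic
coefficients. Since no `β j` vanishes, its solutions form a plane, and translation by one period
acts on this plane as the monodromy. Reading one period of a monodromy eigenvector shows that each
multiplier `r` is nonzero and that `lam` is an eigenvalue of the symbol at `r⁻¹`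
(`eval_charpoly_symbol_eq_zero_of_hasEigenvalue`).

The Fredholm hypothesis excludes zeros of `det (lam - f z)` on the unit circle
(`eval_charpoly_symbol_ne_zero`). The winding sum is the winding of this determinant around `0`, and
`z * det (lam - f z)` is a polynomial in `z`. If the sum is negative, the polynomial winds less than
once, so by the argument principle it has no zero in the disc. Hence all multipliers satisfy `|r| <
1` and every solution of the recurrence decays (`exists_decay_rate`). The perturbation `a` enters
only the first row, which can always be met by choosing the second entry of the solution. This is
why neither existence nor the constant depends on `a`.

For a positive sum, transposition exchanges `β` and `η` and replaces `z` by `z⁻¹`. This reverses the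
eigenvalue curves and reduces the claim to the first case (`sum_wind_reverse`,
`isLeftEigenvector_of_swap`). -/

namespace KToeplitz

/-! ### Winding numbers and the argument principle for polynomials -/

section

theorem exists_isLogLift {γ : ℝ → ℂ} {z : ℂ} (hγ : ContinuousOn γ (Set.Icc 0 (2 * Real.pi)))
    (h : ∀ t ∈ Set.Icc (0 : ℝ) (2 * Real.pi), γ t ≠ z) : ∃ g, IsLogLift γ z g := by
  have hpi : (0 : ℝ) ≤ 2 * Real.pi := by positivity
  -- Extending the path by constants to the simply connected line makes a global logarithm
  -- available.
  set e : ℝ → ℂ := fun t => γ (Set.projIcc 0 (2 * Real.pi) hpi t) - z with he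
  have hc : Continuous e := by
    have h1 : Continuous fun t : ℝ => γ (Set.projIcc 0 (2 * Real.pi) hpi t) :=
      hγ.comp_continuous (continuous_subtype_val.comp continuous_projIcc)
        fun t => (Set.projIcc 0 (2 * Real.pi) hpi t).2
    exact h1.sub continuous_const
  obtain ⟨g, hgc, hg⟩ := Complex.exists_continuousOn_eqOn_exp_comp (X := ℝ) (U := Set.univ)
    (g := e) ⟨by
      have : ContractibleSpace (Set.univ : Set ℝ) := (Homeomorph.Set.univ ℝ).contractibleSpace
      exact (SimplyConnectedSpace.ofContractible _).equiv_unit⟩ isOpen_univ hc.continuousOn (by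
      rintro ⟨t, -, ht⟩
      exact h _ (Set.projIcc 0 (2 * Real.pi) hpi t).2 (sub_eq_zero.1 ht))
  refine ⟨g, hgc.mono (Set.subset_univ _), fun t ht => ?_⟩
  have := hg (Set.mem_univ t)
  simp only [Function.comp_apply, he, Set.projIcc_of_mem hpi ht] at this
  exact this.symm

/-- Two logarithms of one function differ by a continuous function with values in the discrete set
`2πiℤ`, hence by a constant. This makes `wind` computable from any convenient lift. -/
theorem increment_eq_of_exp_eq {g h : ℝ → ℂ} (hg : ContinuousOn g (Set.Icc 0 (2 * Real.pi)))
    (hh : ContinuousOn h (Set.Icc 0 (2 * Real.pi)))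
    (e : ∀ t ∈ Set.Icc (0 : ℝ) (2 * Real.pi), exp (g t) = exp (h t)) :
    g (2 * Real.pi) - g 0 = h (2 * Real.pi) - h 0 := by
  have hpi : (0 : ℝ) ≤ 2 * Real.pi := by positivity
  have hd : DiscreteTopology (Set.range ((↑) : ℤ → ℂ)) :=
    Complex.isClosedEmbedding_intCast.isEmbedding.toHomeomorph.symm.isEmbedding.discreteTopology
  have hne : (2 * Real.pi * I : ℂ) ≠ 0 := by simp
  have key := (isPreconnected_Icc (a := (0 : ℝ)) (b := 2 * Real.pi)).constant_of_mapsTo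
    (T := Set.range ((↑) : ℤ → ℂ)) ⟨hd⟩ (f := fun t => (g t - h t) / (2 * Real.pi * I))
    ((hg.sub hh).div_const _) (by
      intro t ht
      obtain ⟨n, hn⟩ := Complex.exp_eq_exp_iff_exists_int.1 (e t ht)
      refine ⟨n, ?_⟩
      simp only
      rw [eq_div_iff hne, hn]
      ring) (Set.left_mem_Icc.2 hpi) (Set.right_mem_Icc.2 hpi)
  rw [div_left_inj' hne] at key
  linear_combination -key

/-- Write `z - r` as `z (1 - r / z)` if `r` is inside the circle and as `-r (1 - z / r)` if it is
outside. The factor `1 - w` with `|w| < 1` stays in the slit plane, so its principal logarithm is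
continuous and contributes no increment. -/
theorem exists_lift_circle_sub {r : ℂ} (hr : ‖r‖ ≠ 1) : ∃ L : ℝ → ℂ, Continuous L ∧
    (∀ t : ℝ, exp (L t) = exp (t * I) - r) ∧
    (L (2 * Real.pi)).im - (L 0).im = if ‖r‖ < 1 then 2 * Real.pi else 0 := by
  have hslit : ∀ w : ℂ, ‖w‖ < 1 → 1 - w ∈ slitPlane := by
    intro w hw
    refine Or.inl ?_
    have := (abs_le.1 (Complex.abs_re_le_norm w)).2
    simp only [sub_re, one_re]
    linarith
  rcases lt_or_gt_of_ne hr with h | h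
  · have hw : ∀ t : ℝ, 1 - r * exp (-(t * I)) ∈ slitPlane := fun t => hslit _ (by
      rw [norm_mul, ← neg_mul, ← ofReal_neg, norm_exp_ofReal_mul_I, mul_one]; exact h)
    refine ⟨fun t => t * I + log (1 - r * exp (-(t * I))), ?_, fun t => ?_, ?_⟩
    · exact (by fun_prop : Continuous fun t : ℝ => (t * I : ℂ)).add
        (Continuous.clog (by fun_prop) hw)
    · rw [exp_add, exp_log (slitPlane_ne_zero (hw t)), mul_sub, mul_one, mul_left_comm, ← exp_add]
      simp
    · have : exp (-(2 * Real.pi * I)) = 1 := by rw [exp_neg, exp_two_pi_mul_I, inv_one]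
      simp [h, this]
  · have h0 : r ≠ 0 := by rintro rfl; simp at h; linarith
    have hw : ∀ t : ℝ, 1 - exp (t * I) / r ∈ slitPlane := fun t => hslit _ (by
      rw [norm_div, norm_exp_ofReal_mul_I]; exact (div_lt_one (by linarith)).2 h)
    refine ⟨fun t => log (-r) + log (1 - exp (t * I) / r), ?_, fun t => ?_, ?_⟩
    · exact continuous_const.add (Continuous.clog (by fun_prop) hw)
    · rw [exp_add, exp_log (slitPlane_ne_zero (hw t)), exp_log (neg_ne_zero.2 h0)]
      field_simp
      ring
    · simp [h.le.not_gt]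

theorem exists_lift_circle_prod (s : Multiset ℂ) (hs : ∀ r ∈ s, ‖r‖ ≠ 1) :
    ∃ L : ℝ → ℂ, Continuous L ∧
      (∀ t : ℝ, exp (L t) = (s.map fun r => exp (t * I) - r).prod) ∧
      0 ≤ (L (2 * Real.pi)).im - (L 0).im ∧
      ((∃ r ∈ s, ‖r‖ < 1) → 2 * Real.pi ≤ (L (2 * Real.pi)).im - (L 0).im) := by
  induction s using Multiset.induction_on with
  | empty => exact ⟨fun _ => 0, continuous_const, by simp, by simp, by simp⟩
  | cons r s ih =>
    obtain ⟨L, hc, he, h0, h1⟩ := ih fun q hq => hs q (Multiset.mem_cons_of_mem hq)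
    obtain ⟨M, hMc, hMe, hM⟩ := exists_lift_circle_sub (hs r (Multiset.mem_cons_self r s))
    have hpi := Real.pi_pos
    refine ⟨fun t => M t + L t, hMc.add hc, fun t => ?_, ?_, ?_⟩
    · rw [exp_add, hMe, he, Multiset.map_cons, Multiset.prod_cons]
    · simp only [add_im]
      split_ifs at hM <;> linarith
    · rintro ⟨q, hq, hq1⟩
      simp only [add_im]
      rcases Multiset.mem_cons.1 hq with rfl | hq
      · rw [if_pos hq1] at hM
        linarith
      · have := h1 ⟨q, hq, hq1⟩
        split_ifs at hM <;> linarith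

/-- A polynomial without zeros on the unit circle but with a zero inside winds at least once around
the origin. -/
theorem two_pi_le_increment_of_isRoot {p : ℂ[X]} (hp : ∀ z : ℂ, ‖z‖ = 1 → p.eval z ≠ 0)
    {r : ℂ} (hr : ‖r‖ < 1) (hpr : p.eval r = 0) {G : ℝ → ℂ}
    (hG : ContinuousOn G (Set.Icc 0 (2 * Real.pi)))
    (e : ∀ t ∈ Set.Icc (0 : ℝ) (2 * Real.pi), exp (G t) = p.eval (exp (t * I))) :
    2 * Real.pi ≤ (G (2 * Real.pi)).im - (G 0).im := by
  have hp0 : p ≠ 0 := by rintro rfl; exact hp 1 (by simp) (by simp)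
  obtain ⟨L, hLc, hLe, -, hL⟩ := exists_lift_circle_prod p.roots fun q hq hq1 =>
    hp q hq1 (Polynomial.isRoot_of_mem_roots hq)
  have hL := hL ⟨r, (Polynomial.mem_roots hp0).2 hpr, hr⟩
  have key := increment_eq_of_exp_eq hG
    (h := fun t => log p.leadingCoeff + L t) (continuous_const.add hLc).continuousOn (by
      intro t ht
      rw [e t ht, exp_add, hLe, exp_log (leadingCoeff_ne_zero.2 hp0)]
      conv_lhs => rw [(IsAlgClosed.splits p).eq_prod_roots]
      rw [eval_mul, eval_C, eval_multiset_prod, Multiset.map_map]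
      simp)
  have := congrArg Complex.im key
  simp only [sub_im, add_im] at this
  linarith

theorem sum_wind_eq {k : ℕ} {γ : Fin k → ℝ → ℂ} {z : ℂ}
    (hγ : ∀ j, ContinuousOn (γ j) (Set.Icc 0 (2 * Real.pi)))
    (h : ∀ j, ∀ t ∈ Set.Icc (0 : ℝ) (2 * Real.pi), γ j t ≠ z) :
    ∃ G : ℝ → ℂ, ContinuousOn G (Set.Icc 0 (2 * Real.pi)) ∧
      (∀ t ∈ Set.Icc (0 : ℝ) (2 * Real.pi), exp (G t) = ∏ j, (γ j t - z)) ∧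
      ∑ j, wind (γ j) z = ((G (2 * Real.pi)).im - (G 0).im) / (2 * Real.pi) := by
  have hex := fun j => exists_isLogLift (hγ j) (h j)
  refine ⟨fun t => ∑ j, (hex j).choose t,
    continuousOn_finsetSum _ fun j _ => (hex j).choose_spec.1, fun t ht => ?_, ?_⟩
  · rw [exp_sum]
    exact Finset.prod_congr rfl fun j _ => ((hex j).choose_spec.2 t ht).symm
  · simp only [im_sum]
    rw [← Finset.sum_sub_distrib, Finset.sum_div]
    refine Finset.sum_congr rfl fun j _ => ?_
    rw [wind, dif_pos (hex j)]

end

/-! ### The periodic recurrence and its monodromy -/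

section

variable {k : ℕ}

theorem sum_ite_val_eq (g : ℕ → ℂ) (m : ℕ) :
    ∑ j : Fin k, (if (j : ℕ) = m then g j else 0) = if m < k then g m else 0 := by
  rw [Fin.sum_univ_eq_sum_range (fun j => if j = m then g j else 0) k, Finset.sum_ite_eq']
  simp

theorem symbol_transpose (α β η : Fin k → ℂ) (z : ℂ) :
    (symbol α β η z).transpose = symbol α η β z⁻¹ := by
  ext i j
  simp only [symbol, blockNegOne, blockZero, blockOne, Matrix.add_apply, Matrix.smul_apply,
      Matrix.of_apply, smul_eq_mul, Matrix.transpose_apply, inv_inv]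
  have h : (if j = i then α j else if (i : ℕ) = j + 1 then β j else if (j : ℕ) = i + 1 then η i
      else 0) = if i = j then α i else if (j : ℕ) = i + 1 then η i
      else if (i : ℕ) = j + 1 then β j else 0 := by
    split_ifs <;> first | rfl | omega | simp_all
  rw [h]
  simp only [and_comm]
  ring

theorem eval_charpoly_eq_zero_iff (A : Matrix (Fin k) (Fin k) ℂ) (lam : ℂ) :
    A.charpoly.eval lam = 0 ↔ ∃ v ≠ 0, A.mulVec v = lam • v := by
  rw [Matrix.eval_charpoly, ← Matrix.exists_mulVec_eq_zero_iff]
  refine exists_congr fun v => and_congr_right fun _ => ?_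
  rw [Matrix.sub_mulVec, sub_eq_zero, Matrix.scalar_apply, ← Matrix.smul_one_eq_diagonal,
    Matrix.smul_mulVec, Matrix.one_mulVec, eq_comm]

theorem charpoly_symbol_swap (α β η : Fin k → ℂ) (z : ℂ) :
    (symbol α η β z⁻¹).charpoly = (symbol α β η z).charpoly := by
  rw [← symbol_transpose, Matrix.charpoly_transpose]

variable [NeZero k]

theorem periodic_add_period (c : Fin k → ℂ) (n : ℕ) : periodic c (n + k) = periodic c n := by
  simp [periodic, Fin.ofNat]

theorem periodic_val (c : Fin k → ℂ) (i : Fin k) : periodic c i = c i := by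
  simp [periodic]

theorem periodic_ne_zero {c : Fin k → ℂ} (hc : ∏ j, c j ≠ 0) (n : ℕ) : periodic c n ≠ 0 :=
  Finset.prod_ne_zero_iff.1 hc _ (Finset.mem_univ _)

/-- Sequences that satisfy the eigenvalue recurrence of the operator in all rows but the first. -/
def solutionSpace (α β η : Fin k → ℂ) (lam : ℂ) : Submodule ℂ (ℕ → ℂ) where
  carrier := {x | ∀ n, periodic η n * x n + periodic α (n + 1) * x (n + 1) +
    periodic β (n + 1) * x (n + 2) = lam * x (n + 1)}
  add_mem' {x y} hx hy n := by
    simp only [Pi.add_apply]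
    linear_combination hx n + hy n
  zero_mem' n := by simp
  smul_mem' c x hx n := by
    simp only [Pi.smul_apply, smul_eq_mul]
    linear_combination c * hx n

/-- The solution of the recurrence with given first two terms. -/
noncomputable def solution (α β η : Fin k → ℂ) (lam c₀ c₁ : ℂ) : ℕ → ℂ
  | 0 => c₀
  | 1 => c₁
  | n + 2 => ((lam - periodic α (n + 1)) * solution α β η lam c₀ c₁ (n + 1) -
      periodic η n * solution α β η lam c₀ c₁ n) / periodic β (n + 1)

theorem solution_mem (α : Fin k → ℂ) {β : Fin k → ℂ} (η : Fin k → ℂ) (hβ : ∏ j, β j ≠ 0)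
    (lam c₀ c₁ : ℂ) : solution α β η lam c₀ c₁ ∈ solutionSpace α β η lam := by
  intro n
  rw [solution, mul_div_cancel₀ _ (periodic_ne_zero hβ _)]
  ring

theorem eq_zero_of_mem_solutionSpace {α β η : Fin k → ℂ} (hβ : ∏ j, β j ≠ 0) {lam : ℂ} {x : ℕ → ℂ}
    (hx : x ∈ solutionSpace α β η lam) (h0 : x 0 = 0) (h1 : x 1 = 0) : x = 0 := by
  have h : ∀ n, x n = 0 ∧ x (n + 1) = 0 := by
    intro n
    induction n with
    | zero => exact ⟨h0, h1⟩
    | succ n ih =>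
      refine ⟨ih.2, ?_⟩
      have := hx n
      rw [ih.1, ih.2] at this
      simpa [periodic_ne_zero hβ] using this
  exact funext fun n => (h n).1

theorem eq_zero_of_tail_eq_zero {α β η : Fin k → ℂ} (hη : ∏ j, η j ≠ 0) {lam : ℂ} {x : ℕ → ℂ}
    (hx : x ∈ solutionSpace α β η lam) (N : ℕ) (h : ∀ n, N ≤ n → x n = 0) : x = 0 := by
  induction N with
  | zero => exact funext fun n => h n n.zero_le
  | succ N ih =>
    refine ih fun n hn => ?_
    rcases hn.eq_or_lt with rfl | hn
    · have := hx N
      rw [h (N + 1) le_rfl, h (N + 2) (by omega)] at this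
      simpa [periodic_ne_zero hη] using this
    · exact h n hn

/-- The first two terms determine a solution. -/
noncomputable def initialValues (α β η : Fin k → ℂ) (hβ : ∏ j, β j ≠ 0) (lam : ℂ) :
    solutionSpace α β η lam ≃ₗ[ℂ] ℂ × ℂ :=
  LinearEquiv.ofBijective
    { toFun := fun x => (x.1 0, x.1 1)
      map_add' := fun _ _ => rfl
      map_smul' := fun _ _ => rfl }
    ⟨by
      rw [← LinearMap.ker_eq_bot, LinearMap.ker_eq_bot']
      intro x hx
      have h := Prod.mk.inj hx
      exact Subtype.ext (eq_zero_of_mem_solutionSpace hβ x.2 h.1 h.2),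
    fun c => ⟨⟨solution α β η lam c.1 c.2, solution_mem α η hβ lam c.1 c.2⟩, rfl⟩⟩

/-- Translation by one period acts on the solutions. -/
def monodromy (α β η : Fin k → ℂ) (lam : ℂ) : Module.End ℂ (solutionSpace α β η lam) where
  toFun x := ⟨fun n => x.1 (n + k), fun n => by
    have := x.2 (n + k)
    rw [show n + k + 1 = n + 1 + k by ring, show n + k + 2 = n + 2 + k by ring] at this
    simpa only [periodic_add_period] using this⟩
  map_add' _ _ := rfl
  map_smul' _ _ := rfl

theorem monodromy_apply {α β η : Fin k → ℂ} {lam : ℂ} (x : solutionSpace α β η lam) (n : ℕ) :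
    (monodromy α β η lam x).1 n = x.1 (n + k) := rfl

/-- This is Cayley–Hamilton on the solution plane. The factored form splits into two first order
recursions and also covers `r = s` without diagonalizability. -/
theorem exists_monodromy_roots {α β η : Fin k → ℂ} (hβ : ∏ j, β j ≠ 0) (lam : ℂ) :
    ∃ r s : ℂ, (monodromy α β η lam).HasEigenvalue r ∧ (monodromy α β η lam).HasEigenvalue s ∧
      ∀ x ∈ solutionSpace α β η lam, ∀ n,
        x (n + 2 * k) - s * x (n + k) = r * (x (n + k) - s * x n) := by
  have e := initialValues α β η hβ lam
  have hfd : FiniteDimensional ℂ (solutionSpace α β η lam) := e.symm.finiteDimensional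
  have hrank : Module.finrank ℂ (solutionSpace α β η lam) = 2 := by
    rw [e.finrank_eq, Module.finrank_prod, Module.finrank_self]
  set S := monodromy α β η lam
  have hsplit := IsAlgClosed.splits S.charpoly
  have hcard : S.charpoly.roots.card = 2 := by
    rw [← hsplit.natDegree_eq_card_roots, LinearMap.charpoly_natDegree, hrank]
  obtain ⟨r, s, hrs⟩ := Multiset.card_eq_two.1 hcard
  have hroot : ∀ q ∈ S.charpoly.roots, S.HasEigenvalue q := fun q hq =>
    (Module.End.hasEigenvalue_iff_isRoot_charpoly S q).2 (Polynomial.isRoot_of_mem_roots hq)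
  refine ⟨r, s, hroot r (by simp [hrs]), hroot s (by simp [hrs]), fun x hx n => ?_⟩
  have hprod := hsplit.eq_prod_roots
  rw [(LinearMap.charpoly_monic S).leadingCoeff, hrs] at hprod
  have hCH := LinearMap.aeval_self_charpoly S
  rw [hprod] at hCH
  have h := congrArg (fun T : Module.End ℂ (solutionSpace α β η lam) => (T ⟨x, hx⟩).1 n) hCH
  simp [S, monodromy_apply, Module.End.mul_apply] at h
  rw [show n + k + k = n + 2 * k by ring] at h
  linear_combination h

/-! ### Multipliers of the recurrence and eigenvalues of the symbol -/

theorem symbol_mulVec (α β η : Fin k → ℂ) (z : ℂ) (u : ℕ → ℂ) (i : Fin k) :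
    (symbol α β η z).mulVec (fun j => u j) i =
      z⁻¹ * (if (i : ℕ) + 1 = k then periodic β i * u 0 else 0) +
      (periodic α i * u i + (if (i : ℕ) + 1 < k then periodic β i * u (i + 1) else 0) +
        (if 0 < (i : ℕ) then periodic η (i - 1) * u (i - 1) else 0)) +
      z * (if (i : ℕ) = 0 then periodic η (k - 1) * u (k - 1) else 0) := by
  have hk : 0 < k := NeZero.pos k
  have hi := i.2
  have hentry : ∀ j : Fin k, symbol α β η z i j * u j =
      z⁻¹ * (if (j : ℕ) = 0 then (if (i : ℕ) + 1 = k then periodic β i * u j else 0) else 0) +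
      ((if (j : ℕ) = i then periodic α j * u j else 0) +
        (if (j : ℕ) = i + 1 then periodic β i * u j else 0) +
        (if (j : ℕ) = i - 1 then (if 0 < (i : ℕ) then periodic η j * u j else 0) else 0)) +
      z * (if (j : ℕ) = k - 1 then (if (i : ℕ) = 0 then periodic η j * u j else 0) else 0) := by
    intro j
    have hj := j.2
    simp only [symbol, blockNegOne, blockZero, blockOne, Matrix.add_apply, Matrix.smul_apply,
      Matrix.of_apply, smul_eq_mul, periodic_val, Fin.ext_iff, add_mul, mul_assoc, ite_mul,
      zero_mul]
    congr 1
    · congr 1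
      · split_ifs <;> first | rfl | omega
      · split_ifs with h1 <;> first
          | omega
          | (simp; done)
          | (obtain rfl : i = j := Fin.ext h1
             simp)
    · split_ifs <;> first | rfl | omega
  rw [Matrix.mulVec, dotProduct]
  simp only [hentry, Finset.sum_add_distrib, ← Finset.mul_sum]
  rw [sum_ite_val_eq (fun j => if (i : ℕ) + 1 = k then periodic β i * u j else 0),
    sum_ite_val_eq (fun j => periodic α j * u j), sum_ite_val_eq (fun j => periodic β i * u j),
    sum_ite_val_eq (fun j => if 0 < (i : ℕ) then periodic η j * u j else 0),
    sum_ite_val_eq (fun j => if (i : ℕ) = 0 then periodic η j * u j else 0)]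
  rw [if_pos hk, if_pos hi, if_pos (by omega : (i : ℕ) - 1 < k), if_pos (by omega : k - 1 < k)]

/-- The corner entries of the symbol supply the neighbours from the adjacent periods. The row is
written one period later, with `i + (k - 1)` in place of `i - 1`, so that no index becomes negative.
-/
theorem symbol_mulVec_of_quasiperiodic (α β η : Fin k → ℂ) {z : ℂ} (hz : z ≠ 0) {u : ℕ → ℂ}
    (hu : ∀ n, u (n + k) = z⁻¹ * u n) (i : Fin k) :
    (symbol α β η z).mulVec (fun j => u j) i =
      z * (periodic η (i + (k - 1)) * u (i + (k - 1)) +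
        periodic α (i + k) * u (i + k) + periodic β (i + k) * u (i + 1 + k)) := by
  have hk : 0 < k := NeZero.pos k
  have hi := i.2
  rw [symbol_mulVec, hu, hu, periodic_add_period, periodic_add_period]
  have h1 : z⁻¹ * (if (i : ℕ) + 1 = k then periodic β i * u 0 else 0) +
      (if (i : ℕ) + 1 < k then periodic β i * u (i + 1) else 0) = periodic β i * u (i + 1) := by
    by_cases h : (i : ℕ) + 1 = k
    · have := hu 0
      rw [zero_add] at this
      rw [if_pos h, if_neg (by omega), h, this]
      ring
    · rw [if_neg h, if_pos (by omega)]
      ring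
  have h2 : (if 0 < (i : ℕ) then periodic η (i - 1) * u (i - 1) else 0) +
      z * (if (i : ℕ) = 0 then periodic η (k - 1) * u (k - 1) else 0) =
        z * (periodic η (i + (k - 1)) * u (i + (k - 1))) := by
    by_cases h : (i : ℕ) = 0
    · rw [if_pos h, if_neg (by omega), h]
      simp
    · rw [if_neg h, if_pos (by omega), show (i : ℕ) + (k - 1) = i - 1 + k by omega, hu,
        periodic_add_period]
      field_simp
      ring
  have h3 : z * z⁻¹ = 1 := mul_inv_cancel₀ hz
  linear_combination h1 + h2 - (periodic α i * u i + periodic β i * u (i + 1)) * h3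

theorem eval_charpoly_symbol_eq_zero_of_hasEigenvalue {α β η : Fin k → ℂ} (hη : ∏ j, η j ≠ 0)
    {lam r : ℂ} (hr : (monodromy α β η lam).HasEigenvalue r) :
    r ≠ 0 ∧ (symbol α β η r⁻¹).charpoly.eval lam = 0 := by
  have hk : 0 < k := NeZero.pos k
  obtain ⟨x, hx⟩ := hr.exists_hasEigenvector
  have hshift : ∀ n, x.1 (n + k) = r * x.1 n := fun n =>
    congrFun (congrArg Subtype.val hx.apply_eq_smul) n
  have hx0 : x.1 ≠ 0 := fun h => hx.2 (Subtype.ext h)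
  -- A multiplier `0` would make the eigenvector vanish from index `k` on, and the recurrence can be
  -- run backwards because no `η j` is zero.
  have hr0 : r ≠ 0 := by
    rintro rfl
    refine hx0 (eq_zero_of_tail_eq_zero hη x.2 k fun n hn => ?_)
    obtain ⟨m, rfl⟩ := Nat.exists_eq_add_of_le' hn
    rw [hshift, zero_mul]
  refine ⟨hr0, (eval_charpoly_eq_zero_iff _ _).2 ⟨fun j => x.1 j, fun h => hx0 ?_, ?_⟩⟩
  · have hm : ∀ m j, j < k → x.1 (j + m * k) = 0 := by
      intro m
      induction m with
      | zero => intro j hj; simpa using congrFun h ⟨j, hj⟩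
      | succ m ih =>
        intro j hj
        rw [show j + (m + 1) * k = j + m * k + k by ring, hshift, ih j hj, mul_zero]
    funext n
    have := hm (n / k) (n % k) (Nat.mod_lt n hk)
    rwa [mul_comm, Nat.mod_add_div] at this
  · funext i
    rw [symbol_mulVec_of_quasiperiodic α β η (inv_ne_zero hr0) (by simpa using hshift)]
    have := x.2 (i + (k - 1))
    rw [show (i : ℕ) + (k - 1) + 1 = i + k by omega,
      show (i : ℕ) + (k - 1) + 2 = i + 1 + k by omega] at this
    rw [this, hshift, Pi.smul_apply, smul_eq_mul]
    field_simp

/-- An eigenvector of the symbol, continued with the factor `z⁻¹` per period, solves the recurrence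
across the period boundaries too. -/
theorem exists_quasiperiodic_solution {α β η : Fin k → ℂ} {lam z : ℂ} (hz : z ≠ 0)
    (h : (symbol α β η z).charpoly.eval lam = 0) :
    ∃ u ∈ solutionSpace α β η lam, (∀ n, u (n + k) = z⁻¹ * u n) ∧ ∃ r < k, u r ≠ 0 := by
  have hk : 0 < k := NeZero.pos k
  obtain ⟨v, hv0, hv⟩ := (eval_charpoly_eq_zero_iff _ _).1 h
  set u : ℕ → ℂ := fun n => z⁻¹ ^ (n / k) * periodic v n with hu
  have hshift : ∀ n, u (n + k) = z⁻¹ * u n := fun n => by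
    simp only [hu]
    rw [periodic_add_period, Nat.add_div_right _ hk, pow_succ]
    ring
  have huv : (fun j : Fin k => u j) = v := funext fun j => by
    simp only [hu]
    rw [periodic_val, Nat.div_eq_of_lt j.2, pow_zero, one_mul]
  have hrow : ∀ i : Fin k, periodic η (i + (k - 1)) * u (i + (k - 1)) +
      periodic α (i + k) * u (i + k) + periodic β (i + k) * u (i + 1 + k) = lam * u (i + k) := by
    intro i
    have h1 := symbol_mulVec_of_quasiperiodic α β η hz hshift i
    rw [huv, hv, Pi.smul_apply, smul_eq_mul, ← huv] at h1
    apply mul_left_cancel₀ hz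
    rw [← h1, hshift i]
    field_simp
  have hE : ∀ n, n < k → ∀ m, periodic η (n + m * k) * u (n + m * k) +
      periodic α (n + m * k + 1) * u (n + m * k + 1) +
      periodic β (n + m * k + 1) * u (n + m * k + 2) = lam * u (n + m * k + 1) := by
    intro n hn m
    induction m with
    | zero =>
      simp only [zero_mul, add_zero]
      by_cases hnk : n + 1 = k
      · have := hrow ⟨0, hk⟩
        simp only [zero_add] at this
        rw [show k - 1 = n by omega] at this
        rw [hnk, show n + 2 = 1 + k by omega]
        exact this
      · have := hrow ⟨n + 1, by omega⟩
        simp only at this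
        rw [show n + 1 + (k - 1) = n + k by omega, show n + 1 + 1 + k = n + 2 + k by ring,
          hshift, hshift, hshift, periodic_add_period, periodic_add_period,
          periodic_add_period] at this
        apply mul_left_cancel₀ (inv_ne_zero hz)
        linear_combination this
    | succ m ih =>
      rw [show n + (m + 1) * k = n + m * k + k by ring,
        show n + m * k + k + 1 = n + m * k + 1 + k by ring,
        show n + m * k + k + 2 = n + m * k + 2 + k by ring, hshift, hshift, hshift,
        periodic_add_period, periodic_add_period, periodic_add_period]
      linear_combination z⁻¹ * ih
  refine ⟨u, fun n => ?_, hshift, ?_⟩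
  · have := hE (n % k) (Nat.mod_lt n hk) (n / k)
    rwa [mul_comm (n / k), Nat.mod_add_div] at this
  · obtain ⟨i, hi⟩ := Function.ne_iff.1 hv0
    exact ⟨i, i.2, by rw [← huv] at hi; exact hi⟩

/-- The only entry with `z⁻¹` lies in the last row. Multiplying that row by `z` clears it and
multiplies the determinant by `z`. -/
theorem exists_polynomial_charpoly_symbol (α β η : Fin k → ℂ) (lam : ℂ) :
    ∃ p : ℂ[X], ∀ z : ℂ, z ≠ 0 → p.eval z = z * (symbol α β η z).charpoly.eval lam := by
  have hk : 0 < k := NeZero.pos k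
  set N : Matrix (Fin k) (Fin k) ℂ[X] := Matrix.of fun i j =>
    (if (i : ℕ) + 1 = k then X else 1) * (C ((Matrix.scalar (Fin k) lam - blockZero α β η) i j)
      - X * C (blockOne η i j)) - C (blockNegOne β i j) with hN
  refine ⟨N.det, fun z hz => ?_⟩
  have hdet : N.det.eval z = (Matrix.of fun i j : Fin k => (if (i : ℕ) + 1 = k then z else 1) *
      (Matrix.scalar (Fin k) lam - symbol α β η z) i j).det := by
    rw [← coe_evalRingHom, RingHom.map_det]
    congr 1
    ext i j
    simp only [hN, RingHom.mapMatrix_apply, Matrix.map_apply, Matrix.of_apply, coe_evalRingHom,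
      eval_sub, eval_mul, eval_C, eval_X, symbol, Matrix.sub_apply, Matrix.add_apply,
      Matrix.smul_apply, smul_eq_mul]
    by_cases h : (i : ℕ) + 1 = k
    · simp only [if_pos h, eval_X]
      field_simp
      ring
    · simp only [eval_one, blockNegOne, Matrix.of_apply, h, false_and, if_false]
      ring
  rw [hdet, Matrix.det_mul_column, Matrix.eval_charpoly,
    Finset.prod_eq_single (⟨k - 1, by omega⟩ : Fin k)]
  · rw [if_pos (by simp only; omega)]
  · intro i _ hi
    rw [if_neg fun h => hi (Fin.ext (by simp only; omega))]
  · simp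

end

/-! ### Fredholmness excludes zeros on the unit circle -/

section

variable {k : ℕ} [NeZero k]

/-- Summation by parts: the transpose exchanges `β` and `η`, and truncation leaves one boundary
term. On the right the action carries the same `a`; the boundary term does not involve it. -/
theorem sum_mul_perturbedAction (α β η : Fin k → ℂ) (a : ℂ) (x y : ℕ → ℂ) (N : ℕ) :
    ∑ i ∈ Finset.range (N + 1), x i * perturbedAction α β η a y i =
      ∑ i ∈ Finset.range (N + 1), perturbedAction α η β a x i * y i +
        (periodic β N * x N * y (N + 1) - periodic η N * x (N + 1) * y N) := by
  induction N with
  | zero =>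
    simp only [zero_add, Finset.sum_range_one, perturbedAction]
    ring
  | succ N ih =>
    rw [Finset.sum_range_succ, ih, Finset.sum_range_succ _ (N + 1)]
    simp only [perturbedAction]
    ring

theorem exists_norm_periodic_le (c : Fin k → ℂ) : ∃ B, ∀ n, ‖periodic c n‖ ≤ B :=
  ⟨∑ i, ‖c i‖, fun n => Finset.single_le_sum (f := fun i => ‖c i‖) (fun _ _ => norm_nonneg _)
    (Finset.mem_univ (Fin.ofNat k n))⟩

theorem perturbedAction_of_mem_solutionSpace {α β η : Fin k → ℂ} {lam : ℂ} {x : ℕ → ℂ}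
    (hx : x ∈ solutionSpace α β η lam) (a : ℂ) (n : ℕ) :
    perturbedAction α β η a x (n + 1) = lam * x (n + 1) := hx n

theorem norm_apply_le (y : EllTwo) (n : ℕ) : ‖y n‖ ≤ ‖y‖ :=
  lp.norm_apply_le_norm (by norm_num) y n

/-- Pairing a bounded solution of the transposed recurrence with an element of the range of
`T - λ` gives bounded partial sums. -/
theorem exists_norm_sum_mul_le {α β η : Fin k → ℂ} {lam : ℂ} {u : ℕ → ℂ}
    (hu : u ∈ solutionSpace α η β lam) {B : ℝ} (hB : ∀ n, ‖u n‖ ≤ B) (a : ℂ) (y : EllTwo) :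
    ∃ K, ∀ N, ‖∑ i ∈ Finset.range N,
      u i * (perturbedToeplitz α β η a - lam • ContinuousLinearMap.id ℂ EllTwo) y i‖ ≤ K := by
  obtain ⟨Bβ, hβ⟩ := exists_norm_periodic_le β
  obtain ⟨Bη, hη⟩ := exists_norm_periodic_le η
  have hB0 : 0 ≤ B := (norm_nonneg _).trans (hB 0)
  have hβ0 : 0 ≤ Bβ := (norm_nonneg _).trans (hβ 0)
  have hη0 : 0 ≤ Bη := (norm_nonneg _).trans (hη 0)
  refine ⟨‖(perturbedAction α η β a u 0 - lam * u 0) * y 0‖ +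
    (Bβ * B * ‖y‖ + Bη * B * ‖y‖), fun N => ?_⟩
  cases N with
  | zero =>
    simp only [Finset.range_zero, Finset.sum_empty, norm_zero]
    positivity
  | succ N =>
    -- As `u` solves all rows but the first, only row `0` and the boundary term at `N` survive.
    have h1 : ∑ i ∈ Finset.range (N + 1),
        u i * (perturbedToeplitz α β η a - lam • ContinuousLinearMap.id ℂ EllTwo) y i =
        (perturbedAction α η β a u 0 - lam * u 0) * y 0 +
          (periodic β N * u N * y (N + 1) - periodic η N * u (N + 1) * y N) := by
      have h2 : ∀ i, u i * (perturbedToeplitz α β η a - lam • ContinuousLinearMap.id ℂ EllTwo) y i =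
          u i * perturbedAction α β η a y i - lam * u i * y i := fun i => by
        change u i * (perturbedAction α β η a y i - lam * y i) = _
        ring
      simp only [h2]
      rw [Finset.sum_sub_distrib, sum_mul_perturbedAction, add_sub_right_comm,
        ← Finset.sum_sub_distrib, Finset.sum_range_succ']
      simp only [perturbedAction_of_mem_solutionSpace hu, sub_self, Finset.sum_const_zero]
      ring
    rw [h1]
    refine (norm_add_le _ _).trans (add_le_add le_rfl ((norm_sub_le _ _).trans ?_))
    simp only [norm_mul]
    gcongr
    · exact hβ N
    · exact hB N
    · exact norm_apply_le y _
    · exact hη N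
    · exact hB _
    · exact norm_apply_le y _

open Filter Asymptotics in
-- Otherwise the term of largest index with nonzero coefficient dominates the others and tends to
-- infinity in norm, contradicting the bound.
theorem eq_zero_of_bounded_combination {h : ℕ → ℕ → ℝ}
    (hlt : ∀ i j, i < j → h i =o[atTop] h j) (htop : ∀ i, Tendsto (h i) atTop atTop)
    (s : Finset ℕ) (g : ℕ → ℂ) {K : ℝ} (hK : ∀ N, ‖∑ i ∈ s, g i * (h i N : ℂ)‖ ≤ K) :
    ∀ i ∈ s, g i = 0 := by
  by_contra! hne
  obtain ⟨i₀, hi₀, hg₀⟩ := hne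
  set t := s.filter fun i => g i ≠ 0
  have ht : t.Nonempty := ⟨i₀, by simp [t, hi₀, hg₀]⟩
  set j := t.max' ht
  have hj : j ∈ t := t.max'_mem ht
  obtain ⟨hjs, hgj⟩ := Finset.mem_filter.1 hj
  have hrest : ∀ i ∈ s.erase j, (fun N => g i * (h i N : ℂ)) =o[atTop] h j := by
    intro i hi
    obtain ⟨hij, his⟩ := Finset.mem_erase.1 hi
    by_cases hgi : g i = 0
    · simp only [hgi, zero_mul]
      exact isLittleO_zero _ _
    · have hi' : i < j := lt_of_le_of_ne (t.le_max' i (Finset.mem_filter.2 ⟨his, hgi⟩)) hij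
      refine IsLittleO.const_mul_left ?_ _
      exact (isLittleO_norm_left.1 (by simpa using (hlt i j hi').norm_left))
  have htot : (fun N => ∑ i ∈ s, g i * (h i N : ℂ)) =o[atTop] h j := by
    have hO : (fun N => ∑ i ∈ s, g i * (h i N : ℂ)) =O[atTop] fun _ => (1 : ℝ) :=
      IsBigO.of_bound K (Eventually.of_forall fun N => by simpa using hK N)
    refine hO.trans_isLittleO ?_
    rw [isLittleO_const_left]
    exact Or.inr (tendsto_norm_atTop_atTop.comp (htop j))
  have hself : (fun N => g j * (h j N : ℂ)) =o[atTop] h j := by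
    refine (htot.sub (IsLittleO.sum hrest)).congr_left fun N => ?_
    rw [Finset.sum_apply, ← Finset.add_sum_erase s _ hjs]
    ring
  have hself' : h j =o[atTop] h j :=
    isLittleO_norm_left.1 (by
      simpa using ((isLittleO_const_mul_left_iff hgj).1 hself).norm_left)
  exact isLittleO_irrefl ((htop j).eventually_gt_atTop 0 |>.frequently.mono
    fun N hN => hN.ne') hself'

open Filter Asymptotics in
theorem isLittleO_natCast_add_one_rpow {p q : ℝ} (hpq : p < q) :
    (fun n : ℕ => ((n : ℝ) + 1) ^ p) =o[atTop] fun n : ℕ => ((n : ℝ) + 1) ^ q := by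
  have hpos : ∀ n : ℕ, (0 : ℝ) < n + 1 := fun n => by positivity
  refine isLittleO_of_tendsto (fun n hn => absurd hn (Real.rpow_pos_of_pos (hpos n) q).ne') ?_
  have h1 : Tendsto (fun n : ℕ => (n : ℝ) + 1) atTop atTop :=
    tendsto_atTop_add_const_right _ _ tendsto_natCast_atTop_atTop
  refine ((tendsto_rpow_neg_atTop (sub_pos.2 hpq)).comp h1).congr fun n => ?_
  rw [Function.comp_apply, ← Real.rpow_sub (hpos n), neg_sub]

theorem not_summable_mul_rpow {c : ℕ → ℝ} (hc : ∀ n, c (n + k) = c n) {r : ℕ} (hr : r < k)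
    (hcr : 0 < c r) {s : ℝ} (hs0 : 0 ≤ s) (hs1 : s ≤ 1) :
    ¬ Summable fun n : ℕ => c n * ((n : ℝ) + 1) ^ (-s) := by
  have hk : 0 < k := NeZero.pos k
  intro h
  have hcm : ∀ m, c (r + m * k) = c r := by
    intro m
    induction m with
    | zero => simp
    | succ m ih => rw [show r + (m + 1) * k = r + m * k + k by ring, hc, ih]
  have hinj : Function.Injective fun m => r + m * k := fun m n hmn => by
    simpa [hk.ne'] using hmn
  have h1 := h.comp_injective hinj
  have hk1 : (0 : ℝ) < (k : ℝ) ^ (-s) := Real.rpow_pos_of_pos (by exact_mod_cast hk) _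
  have h2 : Summable fun m : ℕ => (c r * (k : ℝ) ^ (-s)) * ((m : ℝ) + 1) ^ (-s) := by
    refine h1.of_nonneg_of_le (fun m => by positivity) fun m => ?_
    simp only [Function.comp_apply, hcm]
    rw [mul_assoc, ← Real.mul_rpow (by positivity) (by positivity)]
    refine mul_le_mul_of_nonneg_left ?_ hcr.le
    refine Real.rpow_le_rpow_of_nonpos (by positivity) ?_ (neg_nonpos.2 hs0)
    have : (r : ℝ) + 1 ≤ k := by exact_mod_cast hr
    push_cast
    linarith
  have h3 := (summable_mul_left_iff (mul_pos hcr hk1).ne').1 h2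
  refine absurd ((Real.summable_one_div_nat_add_rpow 1 s).1 (h3.congr fun m => ?_)) hs1.not_gt
  rw [abs_of_pos (by positivity), Real.rpow_neg (by positivity), one_div]

theorem memlp_conj_mul_rpow {u : ℕ → ℂ} {B : ℝ} (hB : ∀ n, ‖u n‖ ≤ B) {s : ℝ} (hs : 1 / 2 < s) :
    Memℓp (E := fun _ : ℕ => ℂ)
      (fun n : ℕ => (starRingEnd ℂ) (u n) * ((((n : ℝ) + 1) ^ (-s) : ℝ) : ℂ)) 2 := by
  rw [memlp_iff]
  have h1 : Summable fun n : ℕ => B ^ 2 * (1 / |(n : ℝ) + 1| ^ (2 * s)) :=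
    ((Real.summable_one_div_nat_add_rpow 1 (2 * s)).2 (by linarith)).mul_left _
  refine h1.of_nonneg_of_le (fun n => by positivity) fun n => ?_
  have hn : (0 : ℝ) < n + 1 := by positivity
  rw [norm_mul, mul_pow, RCLike.norm_conj, Complex.norm_real, Real.norm_eq_abs, sq_abs,
    abs_of_pos hn, ← Real.rpow_natCast ((n + 1 : ℝ) ^ (-s)), ← Real.rpow_mul hn.le, one_div,
    ← Real.rpow_neg hn.le, show -s * ((2 : ℕ) : ℝ) = -(2 * s) by push_cast; ring]
  gcongr
  exact hB n

open Filter Asymptotics in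
/-- If `T - λ` is Fredholm, then `λ` is no eigenvalue of the symbol on the unit circle. -/
theorem eval_charpoly_symbol_ne_zero {α β η : Fin k → ℂ} {a lam : ℂ}
    (hlam : lam ∉ essentialSpectrum (perturbedToeplitz α β η a)) {z : ℂ} (hz : ‖z‖ = 1) :
    (symbol α β η z).charpoly.eval lam ≠ 0 := by
  intro h0
  have hk : 0 < k := NeZero.pos k
  have hfred : (perturbedToeplitz α β η a - lam • ContinuousLinearMap.id ℂ EllTwo).IsFredholm :=
    not_not.1 hlam
  set T := perturbedToeplitz α β η a - lam • ContinuousLinearMap.id ℂ EllTwo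
  have hz0 : z ≠ 0 := by rintro rfl; simp at hz
  -- A zero on the circle yields a solution `u` of the transposed recurrence with unimodular
  -- multiplier: bounded, but not decaying.
  obtain ⟨u, hu, hshift, r, hr, hur⟩ := exists_quasiperiodic_solution (inv_ne_zero hz0)
    (by rw [charpoly_symbol_swap]; exact h0)
  have hnorm : ∀ n, ‖u (n + k)‖ = ‖u n‖ := fun n => by
    rw [hshift, inv_inv, norm_mul, hz, one_mul]
  have hB : ∀ n, ‖u n‖ ≤ ∑ j ∈ Finset.range k, ‖u j‖ := by
    intro n
    induction n using Nat.strong_induction_on with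
    | _ n ih =>
      by_cases hn : n < k
      · exact Finset.single_le_sum (f := fun j => ‖u j‖) (fun _ _ => norm_nonneg _)
          (Finset.mem_range.2 hn)
      · obtain ⟨m, rfl⟩ := Nat.exists_eq_add_of_le' (not_lt.1 hn)
        rw [hnorm]
        exact ih m (by omega)
  -- The exponents decrease strictly within `(1/2, 1]`. Above `1/2` the vectors `conj u * (n + 1) ^
  -- (-σ i)` lie in `ℓ²`; up to `1` their pairings with `u` diverge, at different orders for
  -- different `i`.
  set σ : ℕ → ℝ := fun i => 1 / 2 + 1 / (2 * ((i : ℝ) + 1)) with hσ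
  have hσ1 : ∀ i, 1 / 2 < σ i := fun i => by
    simp only [hσ]
    linarith [show (0 : ℝ) < 1 / (2 * ((i : ℝ) + 1)) by positivity]
  have hσ2 : ∀ i, σ i ≤ 1 := fun i => by
    have : (1 : ℝ) / (2 * ((i : ℝ) + 1)) ≤ 1 / 2 := by
      gcongr
      linarith [show (0 : ℝ) ≤ i by positivity]
    simp only [hσ]
    linarith
  have hσ3 : ∀ i j, i < j → σ j < σ i := fun i j hij => by
    simp only [hσ]
    gcongr
  set e : ℕ → EllTwo := fun i => ⟨_, memlp_conj_mul_rpow hB (hσ1 i)⟩ with he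
  set h : ℕ → ℕ → ℝ := fun i N => ∑ n ∈ Finset.range N, ‖u n‖ ^ 2 * ((n : ℝ) + 1) ^ (-σ i) with hh
  have hnn : ∀ i n, 0 ≤ ‖u n‖ ^ 2 * ((n : ℝ) + 1) ^ (-σ i) := fun i n => by positivity
  have htop : ∀ i, Tendsto (h i) atTop atTop := fun i =>
    (not_summable_iff_tendsto_nat_atTop_of_nonneg (hnn i)).1
      (not_summable_mul_rpow (k := k) (c := fun n => ‖u n‖ ^ 2) (fun n => by simp only [hnorm]) hr
        (by positivity) (by linarith [hσ1 i]) (hσ2 i))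
  have hlt : ∀ i j, i < j → h i =o[atTop] h j := fun i j hij =>
    IsLittleO.sum_range ((isBigO_refl _ _).mul_isLittleO
      (isLittleO_natCast_add_one_rpow (neg_lt_neg (hσ3 i j hij)))) (hnn j) (htop j)
  have hfin : Module.Finite ℂ (EllTwo ⧸ T.range) := hfred.finite_coker
  -- Finite codimension puts a nontrivial combination of the `e i` in the range, where pairing with
  -- `u` has bounded partial sums. This is impossible for the divergent orders above.
  have hdep : ¬ LinearIndependent ℂ fun i => T.range.mkQ (e i) := fun hli =>
    not_finite_iff_infinite.2 inferInstance hli.finite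
  obtain ⟨s, g, hsum, i, his, hgi⟩ := not_linearIndependent_iff.1 hdep
  simp only [← map_smul, ← map_sum] at hsum
  obtain ⟨y, hy⟩ := (Submodule.Quotient.mk_eq_zero _).1 hsum
  obtain ⟨K, hK⟩ := exists_norm_sum_mul_le hu hB a y
  refine hgi (eq_zero_of_bounded_combination hlt htop s g (K := K) (fun N => ?_) i his)
  refine le_of_eq_of_le (congrArg norm ?_) (hK N)
  have hy' : ∀ n, T y n = ∑ i ∈ s, g i * e i n := fun n => by
    have : T y = ∑ i ∈ s, g i • e i := hy
    rw [this, lp.coeFn_sum, Finset.sum_apply]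
    rfl
  change _ = ∑ n ∈ Finset.range N, u n * T y n
  simp only [hy', hh, Finset.mul_sum, ofReal_sum]
  rw [Finset.sum_comm]
  refine Finset.sum_congr rfl fun n _ => Finset.sum_congr rfl fun i _ => ?_
  simp only [he]
  rw [ofReal_mul, ofReal_pow, ← Complex.mul_conj']
  ring

end

/-! ### Winding sum of the eigenvalue curves and location of the zeros -/

section

variable {k : ℕ}

theorem prod_sub_eq_eval_charpoly {f : ℂ → Matrix (Fin k) (Fin k) ℂ} {μ : Fin k → ℝ → ℂ}
    (hμ : IsEigenvalueCurves f μ) (lam : ℂ) {t : ℝ} (ht : t ∈ Set.Icc (0 : ℝ) (2 * Real.pi)) :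
    ∏ j, (μ j t - lam) = (-1) ^ k * (f (exp (t * I))).charpoly.eval lam := by
  rw [hμ.2 t ht, eval_prod]
  simp only [eval_sub, eval_X, eval_C]
  rw [← Fin.prod_const, ← Finset.prod_mul_distrib]
  exact Finset.prod_congr rfl fun j _ => by ring

theorem exists_lift_eval_charpoly {f : ℂ → Matrix (Fin k) (Fin k) ℂ} {μ : Fin k → ℝ → ℂ}
    (hμ : IsEigenvalueCurves f μ) {lam : ℂ}
    (hcirc : ∀ z : ℂ, ‖z‖ = 1 → (f z).charpoly.eval lam ≠ 0) :
    ∃ G : ℝ → ℂ, ContinuousOn G (Set.Icc 0 (2 * Real.pi)) ∧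
      (∀ t ∈ Set.Icc (0 : ℝ) (2 * Real.pi),
        exp (G t) = (-1) ^ k * (f (exp (t * I))).charpoly.eval lam) ∧
      ∑ j, wind (μ j) lam = ((G (2 * Real.pi)).im - (G 0).im) / (2 * Real.pi) := by
  obtain ⟨G, hGc, hG, hw⟩ := sum_wind_eq (z := lam) hμ.1 fun j t ht h => by
    refine hcirc (exp (t * I)) (norm_exp_ofReal_mul_I t) ?_
    rw [hμ.2 t ht, eval_prod]
    exact Finset.prod_eq_zero (Finset.mem_univ j) (by simp [h])
  exact ⟨G, hGc, fun t ht => (hG t ht).trans (prod_sub_eq_eval_charpoly hμ lam ht), hw⟩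

/-- Since `exp (i (2π - t))` is the inverse of `exp (i t)`, the curves of `g` are those of `f` run
backwards. -/
theorem sum_wind_reverse {f g : ℂ → Matrix (Fin k) (Fin k) ℂ} {μ : Fin k → ℝ → ℂ}
    (hfg : ∀ z, (g z⁻¹).charpoly = (f z).charpoly) (hμ : IsEigenvalueCurves f μ) {lam : ℂ}
    (hcirc : ∀ z : ℂ, ‖z‖ = 1 → (f z).charpoly.eval lam ≠ 0) :
    IsEigenvalueCurves g (fun j t => μ j (2 * Real.pi - t)) ∧
      (∀ z : ℂ, ‖z‖ = 1 → (g z).charpoly.eval lam ≠ 0) ∧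
      ∑ j, wind (fun t => μ j (2 * Real.pi - t)) lam = -∑ j, wind (μ j) lam := by
  have hmaps : ∀ t ∈ Set.Icc (0 : ℝ) (2 * Real.pi),
      2 * Real.pi - t ∈ Set.Icc (0 : ℝ) (2 * Real.pi) := fun t ht =>
    ⟨by linarith [ht.2], by linarith [ht.1]⟩
  have hexp : ∀ t : ℝ, exp (t * I) = (exp ((2 * Real.pi - t : ℝ) * I))⁻¹ := fun t => by
    rw [← exp_neg, exp_eq_exp_iff_exists_int]
    exact ⟨1, by push_cast; ring⟩
  have hcont : ContinuousOn (fun t : ℝ => 2 * Real.pi - t) (Set.Icc 0 (2 * Real.pi)) := by fun_prop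
  have hcurves : IsEigenvalueCurves g (fun j t => μ j (2 * Real.pi - t)) :=
    ⟨fun j => (hμ.1 j).comp hcont hmaps, fun t ht => by
      rw [hexp t, hfg]
      exact hμ.2 _ (hmaps t ht)⟩
  have hcirc' : ∀ z : ℂ, ‖z‖ = 1 → (g z).charpoly.eval lam ≠ 0 := fun z hz => by
    have := hcirc z⁻¹ (by rw [norm_inv, hz, inv_one])
    rwa [← hfg, inv_inv] at this
  refine ⟨hcurves, hcirc', ?_⟩
  obtain ⟨G, hGc, hG, hw⟩ := exists_lift_eval_charpoly hμ hcirc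
  obtain ⟨H, hHc, hH, hw'⟩ := exists_lift_eval_charpoly hcurves hcirc'
  have key := increment_eq_of_exp_eq hHc (hGc.comp hcont hmaps) fun t ht => by
    rw [hH t ht, Function.comp_apply, hG _ (hmaps t ht), hexp t, hfg]
  have := congrArg Complex.im key
  simp only [Function.comp_apply, sub_self, sub_zero, sub_im] at this
  rw [hw, hw', this]
  ring

variable [NeZero k]

theorem eval_charpoly_symbol_ne_zero_of_sum_wind_neg {α β η : Fin k → ℂ} {μ : Fin k → ℝ → ℂ}
    (hμ : IsEigenvalueCurves (symbol α β η) μ) {lam : ℂ}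
    (hcirc : ∀ z : ℂ, ‖z‖ = 1 → (symbol α β η z).charpoly.eval lam ≠ 0)
    (hneg : ∑ j, wind (μ j) lam < 0) {z : ℂ} (hz : z ≠ 0) (hz1 : ‖z‖ ≤ 1) :
    (symbol α β η z).charpoly.eval lam ≠ 0 := by
  intro h0
  obtain ⟨p, hp⟩ := exists_polynomial_charpoly_symbol α β η lam
  obtain ⟨G, hGc, hG, hw⟩ := exists_lift_eval_charpoly hμ hcirc
  have hlt : ‖z‖ < 1 := lt_of_le_of_ne hz1 fun h => hcirc z h h0
  have hunit : (-1 : ℂ) ^ k ≠ 0 := by simp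
  -- The extra factor `z` adds `t * I` to the lift `G`. A zero in the disc would force a total
  -- increment of at least `2π`, so `G` itself would have a nonnegative one.
  have hle := two_pi_le_increment_of_isRoot (p := C ((-1) ^ k) * p) (r := z)
    (G := fun t => G t + t * I) (fun q hq => by
      have hq0 : q ≠ 0 := by rintro rfl; simp at hq
      rw [eval_mul, eval_C, hp q hq0]
      exact mul_ne_zero hunit (mul_ne_zero hq0 (hcirc q hq)))
    hlt (by rw [eval_mul, hp z hz, h0, mul_zero, mul_zero])
    (hGc.add (by fun_prop)) (fun t ht => by
      rw [exp_add, hG t ht, eval_mul, eval_C, hp _ (exp_ne_zero _)]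
      ring)
  have hpi := Real.two_pi_pos
  rw [hw, div_lt_iff₀ hpi, zero_mul] at hneg
  simp only [add_im, mul_I_im, ofReal_re] at hle
  linarith

/-! ### Decaying eigenvectors -/

theorem exists_decay_rate {α β η : Fin k → ℂ} (hη : ∏ j, η j ≠ 0) (hβ : ∏ j, β j ≠ 0) {lam : ℂ}
    (hD : ∀ z : ℂ, z ≠ 0 → ‖z‖ ≤ 1 → (symbol α β η z).charpoly.eval lam ≠ 0) :
    ∃ ρ : ℝ, 0 < ρ ∧ ρ < 1 ∧ ∀ x ∈ solutionSpace α β η lam, ∀ B, (∀ n, n < 2 * k → ‖x n‖ ≤ B) →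
      ∀ m r, r < k → ‖x (r + m * k)‖ ≤ 5 * (m + 1) * ρ ^ m * B := by
  have hev : ∀ r : ℂ, (monodromy α β η lam).HasEigenvalue r → ‖r‖ < 1 := fun r hr => by
    obtain ⟨hr0, h⟩ := eval_charpoly_symbol_eq_zero_of_hasEigenvalue hη hr
    by_contra! hle
    exact hD r⁻¹ (inv_ne_zero hr0) (by rw [norm_inv]; exact inv_le_one_of_one_le₀ hle) h
  obtain ⟨q, s, hq, hs, hrec⟩ := exists_monodromy_roots (α := α) (η := η) hβ lam
  -- The floor `1/2` keeps `ρ` positive and gives `2 ≤ 4 * ρ`. This lets the estimate `(1 + 4 * m) *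
  -- ρ ^ m * B` pass from `m` to `m + 1`, and `1 + 4 * m ≤ 5 * (m + 1)` is the source of the
  -- constant `5`.
  set ρ : ℝ := max (1 / 2) (max ‖q‖ ‖s‖) with hρ
  have hρ2 : 1 / 2 ≤ ρ := le_max_left _ _
  have hqρ : ‖q‖ ≤ ρ := (le_max_left _ _).trans (le_max_right _ _)
  have hsρ : ‖s‖ ≤ ρ := (le_max_right _ _).trans (le_max_right _ _)
  have hρ0 : 0 < ρ := by linarith
  refine ⟨ρ, hρ0, max_lt (by norm_num) (max_lt (hev q hq) (hev s hs)),
    fun x hx B hB m r hr => ?_⟩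
  have hB0 : 0 ≤ B := (norm_nonneg _).trans (hB r (by omega))
  -- The defect from being geometric with ratio `s` is itself geometric with ratio `q`. Solving the
  -- remaining first order recursion costs the factor linear in `m`.
  have hd : ∀ m, ‖x (r + m * k + k) - s * x (r + m * k)‖ ≤ ρ ^ m * (2 * B) := by
    intro m
    induction m with
    | zero =>
      simp only [zero_mul, add_zero, pow_zero, one_mul]
      refine (norm_sub_le _ _).trans ?_
      rw [norm_mul]
      have h1 := hB (r + k) (by omega)
      have h2 : ‖s‖ * ‖x r‖ ≤ 1 * B :=
        mul_le_mul (hev s hs).le (hB r (by omega)) (norm_nonneg _) zero_le_one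
      linarith
    | succ m ih =>
      have := hrec x hx (r + m * k)
      rw [show r + (m + 1) * k + k = r + m * k + 2 * k by ring,
        show r + (m + 1) * k = r + m * k + k by ring, this, norm_mul, pow_succ', mul_assoc]
      gcongr
  have hy : ∀ m : ℕ, ‖x (r + m * k)‖ ≤ (1 + 4 * m) * ρ ^ m * B := by
    intro m
    induction m with
    | zero => simpa using hB r (by omega)
    | succ m ih =>
      rw [show r + (m + 1) * k = r + m * k + k by ring,
        show x (r + m * k + k) = s * x (r + m * k) + (x (r + m * k + k) - s * x (r + m * k)) by ring]
      refine (norm_add_le _ _).trans ?_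
      rw [norm_mul]
      have h1 : ‖s‖ * ‖x (r + m * k)‖ ≤ ρ * ((1 + 4 * m) * ρ ^ m * B) := by gcongr
      have h2 : ρ ^ m * (2 * B) ≤ ρ ^ m * (4 * ρ * B) := by
        gcongr
        linarith
      refine (add_le_add h1 ((hd m).trans h2)).trans (le_of_eq ?_)
      push_cast
      ring
  refine (hy m).trans ?_
  gcongr
  linarith [show (0 : ℝ) ≤ m by positivity]

theorem memlp_of_block_decay {x : ℕ → ℂ} {K ρ : ℝ} (hρ0 : 0 < ρ) (hρ1 : ρ < 1)
    (hx : ∀ m r : ℕ, r < k → ‖x (r + m * k)‖ ≤ K * (m + 1) * ρ ^ m) :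
    Memℓp (E := fun _ : ℕ => ℂ) x 2 := by
  rw [memlp_iff]
  have hρ2 : ‖ρ ^ 2‖ < 1 := by
    rw [Real.norm_of_nonneg (by positivity)]
    exact pow_lt_one₀ hρ0.le hρ1 two_ne_zero
  have h1 : Summable fun m : ℕ => (K * (m + 1) * ρ ^ m) ^ 2 := by
    have h0 : Summable fun m : ℕ => (m : ℝ) ^ 2 * (ρ ^ 2) ^ m :=
      summable_pow_mul_geometric_of_norm_lt_one 2 hρ2
    have h := (summable_nat_add_iff (f := fun m : ℕ => (m : ℝ) ^ 2 * (ρ ^ 2) ^ m) 1).2 h0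
    refine (h.mul_left (K ^ 2 / ρ ^ 2)).congr fun m => ?_
    push_cast
    field_simp
    ring
  have h2 : Summable fun p : ℕ × Fin k => (K * (p.1 + 1) * ρ ^ p.1) ^ 2 * (1 : ℝ) :=
    h1.mul_of_nonneg (Summable.of_finite (f := fun _ : Fin k => (1 : ℝ)))
      (fun m => by positivity) (fun _ => zero_le_one)
  have h3 : Summable fun p : ℕ × Fin k => ‖x ((Nat.divModEquiv k).symm p)‖ ^ 2 := by
    refine h2.of_nonneg_of_le (fun p => by positivity) fun p => ?_
    rw [mul_one, Nat.divModEquiv_symm_apply, add_comm]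
    gcongr
    exact hx p.1 p.2 p.2.2
  exact (Nat.divModEquiv k).symm.summable_iff.1 h3

/-- Converts the block number of the one-based index `n + 1` into that of the zero-based index `n`.
-/
theorem ceil_div_eq (n : ℕ) : ⌈((n + 1 : ℕ) : ℝ) / k⌉₊ = n / k + 1 := by
  have hk : 0 < k := NeZero.pos k
  have hkR : (0 : ℝ) < k := by exact_mod_cast hk
  rw [Nat.ceil_eq_iff (Nat.succ_ne_zero _), Nat.succ_sub_one, lt_div_iff₀ hkR, div_le_iff₀ hkR]
  constructor
  · exact_mod_cast Nat.lt_succ_of_le (Nat.div_mul_le_self n k)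
  · exact_mod_cast Nat.lt_mul_of_div_lt (Nat.lt_succ_self _) hk

theorem norm_le_iSup (x : EllTwo) (n : ℕ) : ‖x n‖ ≤ ⨆ i, ‖x i‖ :=
  le_ciSup (f := fun i => ‖x i‖) ⟨‖x‖, by rintro _ ⟨i, rfl⟩; exact norm_apply_le x i⟩ n

/-- If the symbol has no eigenvalue `λ` in the punctured closed unit disc, then `λ` is an eigenvalue
of the perturbed operator, with a decaying eigenvector. -/
theorem exists_decaying_eigenvector {α β η : Fin k → ℂ} (hη : ∏ j, η j ≠ 0) (hβ : ∏ j, β j ≠ 0)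
    {lam : ℂ} (hD : ∀ z : ℂ, z ≠ 0 → ‖z‖ ≤ 1 → (symbol α β η z).charpoly.eval lam ≠ 0) (a : ℂ) :
    ∃ (x : EllTwo) (ρ : ℝ), 0 < ρ ∧ ρ < 1 ∧ x ≠ 0 ∧ perturbedToeplitz α β η a x = lam • x ∧
      HasBlockDecay k 5 ρ x := by
  have hk : 0 < k := NeZero.pos k
  obtain ⟨ρ, hρ0, hρ1, hρ⟩ := exists_decay_rate hη hβ hD
  -- The second entry is chosen to satisfy the first row, the only one containing `a`.
  set y := solution α β η lam 1 ((lam - periodic α 0 - a) / periodic β 0) with hy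
  have hmem : y ∈ solutionSpace α β η lam := solution_mem α η hβ lam _ _
  have hdecay : ∀ m r : ℕ, r < k →
      ‖y (r + m * k)‖ ≤ 5 * (∑ i ∈ Finset.range (2 * k), ‖y i‖) * (m + 1) * ρ ^ m := fun m r hr => by
    refine (hρ y hmem (∑ i ∈ Finset.range (2 * k), ‖y i‖) (fun n hn =>
      Finset.single_le_sum (f := fun i => ‖y i‖) (fun _ _ => norm_nonneg _)
        (Finset.mem_range.2 hn)) m r hr).trans (le_of_eq (by ring))
  set x : EllTwo := ⟨y, memlp_of_block_decay hρ0 hρ1 hdecay⟩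
  have hx0 : x 0 = 1 := rfl
  refine ⟨x, ρ, hρ0, hρ1, fun h => ?_, ?_, fun j hj => ?_⟩
  · rw [h] at hx0
    exact zero_ne_one hx0
  · ext n
    rw [perturbedToeplitz_apply]
    change perturbedAction α β η a y n = lam * y n
    cases n with
    | zero =>
      change (periodic α 0 + a) * 1 + periodic β 0 * ((lam - periodic α 0 - a) / periodic β 0) =
        lam * 1
      rw [mul_div_cancel₀ _ (periodic_ne_zero hβ 0)]
      ring
    | succ n => exact perturbedAction_of_mem_solutionSpace hmem a n
  · obtain ⟨n, rfl⟩ := Nat.exists_eq_add_of_le' hj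
    have hpos : 0 < ⨆ i, ‖x i‖ := lt_of_lt_of_le (by rw [hx0]; simp) (norm_le_iSup x 0)
    rw [ceil_div_eq, Nat.add_sub_cancel, Nat.add_sub_cancel, div_le_iff₀ hpos]
    -- Taking the supremum itself as the bound on the initial entries makes the constant absolute.
    have := hρ y hmem (⨆ i, ‖x i‖) (fun n _ => norm_le_iSup x n) (n / k) (n % k) (Nat.mod_lt n hk)
    rw [mul_comm (n / k), Nat.mod_add_div] at this
    push_cast
    exact this

/-! ### Left eigenvectors by transposition -/

theorem summable_mul (x y : EllTwo) : Summable fun i => x i * y i := by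
  have hx := (memlp_iff x).1 (lp.memℓp x)
  have hy := (memlp_iff y).1 (lp.memℓp y)
  refine Summable.of_norm_bounded (hx.add hy) fun i => ?_
  rw [norm_mul]
  nlinarith [sq_nonneg (‖x i‖ - ‖y i‖), mul_nonneg (norm_nonneg (x i)) (norm_nonneg (y i))]

open Filter Topology in
theorem tendsto_apply_zero (x : EllTwo) : Tendsto (fun n => x n) atTop (𝓝 0) := by
  have h := ((memlp_iff x).1 (lp.memℓp x)).tendsto_atTop_zero
  rw [tendsto_zero_iff_norm_tendsto_zero]
  have := h.sqrt
  simpa using this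

open Filter Topology in
-- Limit of the finite summation by parts: the boundary terms vanish because `ℓ²` sequences tend to
-- zero.
theorem tsum_mul_perturbedToeplitz (α β η : Fin k → ℂ) (a : ℂ) (x y : EllTwo) :
    ∑' i, x i * perturbedToeplitz α β η a y i = ∑' i, perturbedToeplitz α η β a x i * y i := by
  have hbd : ∀ (c : Fin k → ℂ) (s t : ℕ),
      Tendsto (fun N => periodic c N * x (N + s) * y (N + t)) atTop (𝓝 0) := fun c s t => by
    obtain ⟨B, hB⟩ := exists_norm_periodic_le c
    have hxs := (tendsto_add_atTop_iff_nat s).2 (tendsto_apply_zero x)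
    have hyt := (tendsto_add_atTop_iff_nat t).2 (tendsto_apply_zero y)
    have h := ((hxs.mul hyt).norm.const_mul B)
    simp only [mul_zero, norm_zero] at h
    refine squeeze_zero_norm (fun N => ?_) h
    rw [mul_assoc, norm_mul]
    exact mul_le_mul_of_nonneg_right (hB N) (norm_nonneg _)
  have h1 := (tendsto_add_atTop_iff_nat 1).2
    (summable_mul x (perturbedToeplitz α β η a y)).hasSum.tendsto_sum_nat
  have h2 := ((tendsto_add_atTop_iff_nat 1).2
    (summable_mul (perturbedToeplitz α η β a x) y).hasSum.tendsto_sum_nat).add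
      ((hbd β 0 1).sub (hbd η 1 0))
  rw [sub_zero, add_zero] at h2
  exact tendsto_nhds_unique h1 (h2.congr fun N => (sum_mul_perturbedAction α β η a x y N).symm)

theorem isLeftEigenvector_of_swap {α β η : Fin k → ℂ} {a lam : ℂ} {x : EllTwo} (hx0 : x ≠ 0)
    (hx : perturbedToeplitz α η β a x = lam • x) :
    IsLeftEigenvector (perturbedToeplitz α β η a) lam x := by
  refine ⟨hx0, fun y => ?_⟩
  rw [tsum_mul_perturbedToeplitz, hx, ← tsum_mul_left]
  exact tsum_congr fun i => mul_assoc lam (x i) (y i)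

end

end KToeplitz

theorem mainTheorem6 (k : ℕ) [NeZero k] (α β η : Fin k → ℂ)
    (hη : ∏ j, η j ≠ 0) (hβ : ∏ j, β j ≠ 0) (lam : ℂ) :
    ∃ C₁ : ℝ, 0 < C₁ ∧ ∀ a : ℂ,
      lam ∉ KToeplitz.essentialSpectrum (KToeplitz.perturbedToeplitz α β η a) →
      ∀ μ : Fin k → ℝ → ℂ, KToeplitz.IsEigenvalueCurves (KToeplitz.symbol α β η) μ →
        (∑ j, KToeplitz.wind (μ j) lam < 0 →
          ∃ (x : KToeplitz.EllTwo) (ρ : ℝ), 0 < ρ ∧ ρ < 1 ∧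
            Module.End.HasEigenvector
              (KToeplitz.perturbedToeplitz α β η a : KToeplitz.EllTwo →ₗ[ℂ] KToeplitz.EllTwo)
              lam x ∧
            KToeplitz.HasBlockDecay k C₁ ρ x) ∧
        (0 < ∑ j, KToeplitz.wind (μ j) lam →
          ∃ (x : KToeplitz.EllTwo) (ρ : ℝ), 0 < ρ ∧ ρ < 1 ∧
            KToeplitz.IsLeftEigenvector (KToeplitz.perturbedToeplitz α β η a) lam x ∧
            KToeplitz.HasBlockDecay k C₁ ρ x) := by
  refine ⟨5, by norm_num, fun a hlam μ hμ => ?_⟩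
  have hcirc : ∀ z : ℂ, ‖z‖ = 1 → (KToeplitz.symbol α β η z).charpoly.eval lam ≠ 0 :=
    fun z hz => KToeplitz.eval_charpoly_symbol_ne_zero hlam hz
  refine ⟨fun hneg => ?_, fun hpos => ?_⟩
  · obtain ⟨x, ρ, hρ0, hρ1, hx0, hx, hdecay⟩ := KToeplitz.exists_decaying_eigenvector hη hβ
      (fun _ => KToeplitz.eval_charpoly_symbol_ne_zero_of_sum_wind_neg hμ hcirc hneg) a
    exact ⟨x, ρ, hρ0, hρ1, ⟨Module.End.mem_eigenspace_iff.2 hx, hx0⟩, hdecay⟩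
  -- Exchanging `β` and `η` changes the sign of the winding sum, so the negative case applies to the
  -- transposed operator.
  · obtain ⟨hμ', hcirc', hsum⟩ := KToeplitz.sum_wind_reverse
      (KToeplitz.charpoly_symbol_swap α β η) hμ hcirc
    obtain ⟨x, ρ, hρ0, hρ1, hx0, hx, hdecay⟩ := KToeplitz.exists_decaying_eigenvector hβ hη
      (fun _ => KToeplitz.eval_charpoly_symbol_ne_zero_of_sum_wind_neg hμ' hcirc'
        (by rw [hsum]; exact neg_neg_of_pos hpos)) a
    exact ⟨x, ρ, hρ0, hρ1, KToeplitz.isLeftEigenvector_of_swap hx0 hx, hdecay⟩
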